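/- Let $n, p \ge 1$ be integers, let $S = \{e \in \mathbb{R}^n : \|e\| = 1\}$ be the Euclidean unit sphere with surface measure $\mathrm{d}s$ (counting measure on $\{-1,1\}$ if $n=1$), and let $\Omega_n$ be its total mass. A function $f : \mathbb{R}^{n \times p} \to \mathbb{R} \cup \{\infty\}$ is called matrix superharmonic if 1. $f$ is lower semicontinuous; 2. $f \not\equiv \infty$; 3. $\displaystyle \frac{1}{\Omega_n} \int_S f(X + e \rho^\top)\, \mathrm{d}s(e) \le f(X)$ for every $X \in \mathbb{R}^{n \times p}$ and every $\rho \in \mathbb{R}^p$. Let $\|M\|_{\mathrm{F}} = \big(\sum_{a=1}^n \sum_{i=1}^p M_{ai}^2\big)^{1/2}$ be the Frobenius norm. For $s \le 0$, the function $M \mapsto \|M\|_{\mathrm{F}}^{s}$ is given at $M = 0$ the value $\infty$ if $s < 0$ and $1$ if $s = 0$. **Proposition.** (i) Let $c \ge 0$ be real with $(n,c) \ne (1,0)$. Then $\pi(M) = \|M\|_{\mathrm{F}}^{-c}$ is matrix superharmonic on $\mathbb{R}^{n \times p}$ if and only if $0 \le c \le n-2$. (ii) In particular, if $p \ge 2$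 and $(n,p) \ne (1,2)$, then Stein's prior $\pi_{\mathrm{S}}(M) = \|M\|_{\mathrm{F}}^{2-np}$ is not matrix superharmonic on $\mathbb{R}^{n \times p}$. -/

import Mathlib

open MeasureTheory
open scoped ENNReal

namespace MatrixSH

/-- The surface measure `ds` on the unit sphere `S_{0,1}` of `ℝⁿ` with the Euclidean norm
(for `n = 1` this is the counting measure on `{-1, 1}`). -/
noncomputable def surfaceMeasure (n : ℕ) :
    Measure (Metric.sphere (0 : EuclideanSpace ℝ (Fin n)) 1) :=
  (volume : Measure (EuclideanSpace ℝ (Fin n))).toSphere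

/-- The average `(1 / Ω_n) ∫ g ds` over the unit sphere of `ℝⁿ` of an extended real-valued
function: the average of the positive part minus the average of the negative part. If `g` is
lower semicontinuous and never `-∞`, it is bounded below on the (compact) sphere, so that the
second average is finite and the difference is the usual integral with values in `ℝ ∪ {∞}`. -/
noncomputable def sphereAverage {n : ℕ}
    (g : Metric.sphere (0 : EuclideanSpace ℝ (Fin n)) 1 → EReal) : EReal :=
  (((∫⁻ e, (g e).toENNReal ∂(surfaceMeasure n)) / surfaceMeasure n Set.univ : ℝ≥0∞) : EReal) -
    (((∫⁻ e, (-g e).toENNReal ∂(surfaceMeasure n)) / surfaceMeasure n Set.univ : ℝ≥0∞) : EReal)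

/-- `L(f : X, ρ)`, the average of `f` over `S_{X,ρ} = {X + e ρᵀ : e ∈ ℝⁿ, ‖e‖ = 1}`. -/
noncomputable def rankOneAverage {n p : ℕ} (f : Matrix (Fin n) (Fin p) ℝ → EReal)
    (X : Matrix (Fin n) (Fin p) ℝ) (ρ : Fin p → ℝ) : EReal :=
  sphereAverage fun e : Metric.sphere (0 : EuclideanSpace ℝ (Fin n)) 1 =>
    f (X + Matrix.vecMulVec (fun a => (e : EuclideanSpace ℝ (Fin n)) a) ρ)

/-- Matrix superharmonicity of a function `f : ℝ^{n × p} → ℝ ∪ {∞}`; the codomain `ℝ ∪ {∞}` is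
represented by `EReal` together with the requirement that the value `-∞` is not taken. -/
structure IsMatrixSuperharmonic {n p : ℕ} (f : Matrix (Fin n) (Fin p) ℝ → EReal) : Prop where
  ne_bot : ∀ X, f X ≠ ⊥
  lowerSemicontinuous : LowerSemicontinuous f
  exists_ne_top : ∃ X, f X ≠ ⊤
  average_le : ∀ (X : Matrix (Fin n) (Fin p) ℝ) (ρ : Fin p → ℝ), rankOneAverage f X ρ ≤ f X

/-- The Frobenius norm `‖M‖_F`. -/
noncomputable def frobeniusNorm {n p : ℕ} (M : Matrix (Fin n) (Fin p) ℝ) : ℝ :=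
  letI := Matrix.frobeniusNormedAddCommGroup (m := Fin n) (n := Fin p) (α := ℝ)
  ‖M‖

/-- The function `M ↦ ‖M‖_F ^ s` with values in `ℝ ∪ {∞}`, where at `M = 0` the value is `∞` if
`s < 0` and `1` if `s = 0`. -/
noncomputable def frobeniusPower {n p : ℕ} (s : ℝ) (M : Matrix (Fin n) (Fin p) ℝ) : EReal :=
  ((ENNReal.ofReal (frobeniusNorm M) ^ s : ℝ≥0∞) : EReal)

end MatrixSH

/-! For `r = ‖ρ‖` and `v = X ρ / ‖ρ‖`, expanding the square gives `‖X + e ρᵀ‖² = ‖X‖² + 2 r ⟨v, e⟩ +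
r²`, and `‖v‖ ≤ ‖X‖` by Cauchy–Schwarz. With `d = ‖X‖² - ‖v‖² ≥ 0` and `a = c / 2`, the rank-one
average is thus the mean of `(‖x‖² + d) ^ (-a)` over the sphere of radius `r` about `v` in `ℝⁿ`: the
width `p` enters only through `d`.

For `d > 0` this function is smooth with nonpositive Laplacian when `2 * a ≤ n - 2`, so its
spherical means decrease in `r` (`integral_rpow_neg_le`); Fatou's lemma gives `d = 0`
(`lintegral_rpow_neg_le`). The integration by parts on the sphere that this needs is
`integral_zonal_eq_zero`, obtained by differentiating rotation invariance.

Conversely, at a unit matrix of rank one with `d = 0`, the mean has `r²` coefficient `a (2 a + 2 -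
n) / n`, positive when `c > 0` and `c > n - 2`, so small spheres violate the inequality
(`exists_lt_lintegral_rpow_neg`). Stein's prior has `c = n p - 2 > n - 2`. -/

set_option linter.unusedSectionVars false
open scoped Pointwise

namespace MatrixSH

/-! ### Rotation invariance and integral identities on the sphere -/

section Sphere

variable {E : Type*} [NormedAddCommGroup E] [InnerProductSpace ℝ E] [FiniteDimensional ℝ E]
  [MeasurableSpace E] [BorelSpace E]

local notation "𝕊" => Metric.sphere (0 : E) 1

local notation "σ" => (Measure.toSphere (volume : Measure E))

/-- A linear isometry restricted to the unit sphere. -/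
def sphereMap (R : E ≃ₗᵢ[ℝ] E) (e : 𝕊) : 𝕊 :=
  ⟨R e, by simp⟩

theorem measurePreserving_sphereMap (R : E ≃ₗᵢ[ℝ] E) :
    MeasurePreserving (sphereMap R) σ σ := by
  have hcont : Continuous (sphereMap R) :=
    (R.continuous.comp continuous_subtype_val).subtype_mk _
  refine ⟨hcont.measurable, ?_⟩
  ext s hs
  rw [Measure.map_apply hcont.measurable hs, Measure.toSphere_apply' _ hs,
    Measure.toSphere_apply' _ (hcont.measurable hs)]
  congr 1
  -- The surface measure of a set is a multiple of the volume of the cone over it, and `R` commutes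
  -- with forming cones.
  have hset : Set.Ioo (0 : ℝ) 1 • ((↑) '' (sphereMap R ⁻¹' s) : Set E)
      = R ⁻¹' (Set.Ioo (0 : ℝ) 1 • ((↑) '' s : Set E)) := by
    ext x
    simp only [Set.mem_smul, Set.mem_image, Set.mem_preimage]
    constructor
    · rintro ⟨k, hk, _, ⟨e, he, rfl⟩, rfl⟩
      exact ⟨k, hk, _, ⟨sphereMap R e, he, rfl⟩, by simp [sphereMap]⟩
    · rintro ⟨k, hk, _, ⟨e, he, rfl⟩, hx⟩
      refine ⟨k, hk, _, ⟨sphereMap R.symm e, ?_, rfl⟩, ?_⟩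
      · have : sphereMap R (sphereMap R.symm e) = e := Subtype.ext (by simp [sphereMap])
        rwa [this]
      · apply R.injective
        simp [sphereMap, hx]
  rw [hset]
  exact MeasurePreserving.measure_preimage_equiv (f := R.toHomeomorph.toMeasurableEquiv)
    R.measurePreserving _

theorem integral_sphereMap (R : E ≃ₗᵢ[ℝ] E) {G : 𝕊 → ℝ} (hG : Continuous G) :
    ∫ e, G (sphereMap R e) ∂σ = ∫ e, G e ∂σ := by
  have h := measurePreserving_sphereMap R
  rw [← integral_map h.measurable.aemeasurable hG.aestronglyMeasurable, h.map_eq]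

theorem integrable_sphere {G : 𝕊 → ℝ} (hG : Continuous G) : Integrable G σ :=
  hG.integrable_of_hasCompactSupport (HasCompactSupport.of_compactSpace _)

/-- Differentiation under the integral sign for a finite measure on a compact space. -/
theorem hasDerivAt_integral_of_continuous {S : Type*} [TopologicalSpace S] [CompactSpace S]
    [MeasurableSpace S] [OpensMeasurableSpace S] {μ : Measure S} [IsFiniteMeasure μ]
    {F F' : ℝ → S → ℝ} (hF : ∀ r, Continuous (F r)) (hF' : Continuous fun z : ℝ × S => F' z.1 z.2)
    (h : ∀ r s, HasDerivAt (fun x => F x s) (F' r s) r) (r : ℝ) :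
    HasDerivAt (fun x => ∫ s, F x s ∂μ) (∫ s, F' r s ∂μ) r := by
  have hint : ∀ {g : S → ℝ}, Continuous g → Integrable g μ := fun hg =>
    hg.integrable_of_hasCompactSupport (HasCompactSupport.of_compactSpace _)
  obtain ⟨C, hC⟩ := ((isCompact_Icc (a := r - 1) (b := r + 1)).prod
    (isCompact_univ (X := S))).exists_bound_of_continuousOn hF'.continuousOn
  have hr : Continuous (F' r) := hF'.comp (Continuous.prodMk_right r)
  refine (hasDerivAt_integral_of_dominated_loc_of_deriv_le (bound := fun _ => C)
    (Icc_mem_nhds (by linarith : r - 1 < r) (by linarith : r < r + 1))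
    (Filter.Eventually.of_forall fun x => (hint (hF x)).aestronglyMeasurable) (hint (hF r))
    (hint hr).aestronglyMeasurable (Filter.Eventually.of_forall fun s x hx => ?_)
    (integrable_const C) (Filter.Eventually.of_forall fun s x _ => h x s)).2
  exact hC (x, s) ⟨hx, trivial⟩

/-- The rotation by the angle `θ` in the oriented plane spanned by the orthonormal pair `u, w`. -/
noncomputable def planeRotation {u w : E} (hu : ‖u‖ = 1) (hw : ‖w‖ = 1) (huw : inner ℝ u w = 0)
    (θ : ℝ) : E ≃ₗᵢ[ℝ] E :=
  LinearIsometry.toLinearIsometryEquiv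
    { toFun := fun x => x + ((Real.cos θ - 1) * inner ℝ u x - Real.sin θ * inner ℝ w x) • u
        + ((Real.cos θ - 1) * inner ℝ w x + Real.sin θ * inner ℝ u x) • w
      map_add' := fun x y => by simp only [inner_add_right]; module
      map_smul' := fun k x => by simp only [inner_smul_right, RingHom.id_apply]; module
      norm_map' := fun x => by
        have huu : inner ℝ u u = (1 : ℝ) := by rw [real_inner_self_eq_norm_sq, hu]; norm_num
        have hww : inner ℝ w w = (1 : ℝ) := by rw [real_inner_self_eq_norm_sq, hw]; norm_num
        have hwu : inner ℝ w u = (0 : ℝ) := by rw [real_inner_comm, huw]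
        rw [← sq_eq_sq₀ (norm_nonneg _) (norm_nonneg _), ← real_inner_self_eq_norm_sq,
          ← real_inner_self_eq_norm_sq]
        simp only [LinearMap.coe_mk, AddHom.coe_mk, inner_add_left, inner_add_right,
          inner_smul_left, inner_smul_right, huu, hww, huw, hwu, real_inner_comm u x,
          real_inner_comm w x, conj_trivial]
        linear_combination ((inner ℝ u x) ^ 2 + (inner ℝ w x) ^ 2) * Real.sin_sq_add_cos_sq θ }
    rfl

theorem planeRotation_apply {u w : E} (hu : ‖u‖ = 1) (hw : ‖w‖ = 1) (huw : inner ℝ u w = 0)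
    (θ : ℝ) (x : E) : planeRotation hu hw huw θ x =
      x + ((Real.cos θ - 1) * inner ℝ u x - Real.sin θ * inner ℝ w x) • u
        + ((Real.cos θ - 1) * inner ℝ w x + Real.sin θ * inner ℝ u x) • w := rfl

theorem inner_planeRotation {u w : E} (hu : ‖u‖ = 1) (hw : ‖w‖ = 1) (huw : inner ℝ u w = 0)
    (θ : ℝ) (v x : E) : inner ℝ v (planeRotation hu hw huw θ x) = inner ℝ v x
      + (Real.cos θ - 1) * (inner ℝ u x * inner ℝ u v + inner ℝ w x * inner ℝ w v)
      + Real.sin θ * (inner ℝ u x * inner ℝ w v - inner ℝ w x * inner ℝ u v) := by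
  rw [planeRotation_apply]
  simp only [inner_add_right, inner_smul_right, real_inner_comm u v, real_inner_comm w v]
  ring

theorem wedge_planeRotation {u w : E} (hu : ‖u‖ = 1) (hw : ‖w‖ = 1) (huw : inner ℝ u w = 0)
    (θ : ℝ) (v x : E) :
    inner ℝ u (planeRotation hu hw huw θ x) * inner ℝ w v
        - inner ℝ w (planeRotation hu hw huw θ x) * inner ℝ u v
      = (inner ℝ u x * inner ℝ w v - inner ℝ w x * inner ℝ u v) * Real.cos θ
        - (inner ℝ u x * inner ℝ u v + inner ℝ w x * inner ℝ w v) * Real.sin θ := by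
  have huu : inner ℝ u u = (1 : ℝ) := by rw [real_inner_self_eq_norm_sq, hu]; norm_num
  have hww : inner ℝ w w = (1 : ℝ) := by rw [real_inner_self_eq_norm_sq, hw]; norm_num
  have hwu : inner ℝ w u = (0 : ℝ) := by rw [real_inner_comm, huw]
  rw [inner_planeRotation, inner_planeRotation]
  simp only [huu, hww, huw, hwu]
  ring

theorem inner_mem_Icc (v : E) (e : 𝕊) : inner ℝ v (e : E) ∈ Set.Icc (-‖v‖) ‖v‖ := by
  have h := abs_real_inner_le_norm v (e : E)
  rw [norm_eq_of_mem_sphere e, mul_one] at h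
  exact abs_le.1 h

/-- Rotation invariance of the surface measure in infinitesimal form, in one plane. -/
theorem integral_plane_eq_zero {u w : E} (hu : ‖u‖ = 1) (hw : ‖w‖ = 1) (huw : inner ℝ u w = 0)
    (v : E) {ψ ψ' : ℝ → ℝ} (hψ : ∀ t ∈ Set.Icc (-‖v‖) ‖v‖, HasDerivAt ψ (ψ' t) t)
    (hψ' : ContinuousOn ψ' (Set.Icc (-‖v‖) ‖v‖)) :
    ∫ e : 𝕊, ((inner ℝ u (e : E) * inner ℝ w v - inner ℝ w (e : E) * inner ℝ u v) ^ 2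
        * ψ' (inner ℝ v (e : E))
      - (inner ℝ u (e : E) * inner ℝ u v + inner ℝ w (e : E) * inner ℝ w v)
        * ψ (inner ℝ v (e : E))) ∂σ = 0 := by
  set R := planeRotation hu hw huw with hR
  let p : 𝕊 → ℝ := fun e => inner ℝ u (e : E) * inner ℝ u v + inner ℝ w (e : E) * inner ℝ w v
  let m : 𝕊 → ℝ := fun e => inner ℝ u (e : E) * inner ℝ w v - inner ℝ w (e : E) * inner ℝ u v
  let t : 𝕊 → ℝ := fun e => inner ℝ v (e : E)
  have hp : Continuous p := by fun_prop
  have hm : Continuous m := by fun_prop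
  have ht : Continuous t := by fun_prop
  let T : ℝ → 𝕊 → ℝ := fun θ e => t e + (Real.cos θ - 1) * p e + Real.sin θ * m e
  have hTR : ∀ θ e, t (sphereMap (R θ) e) = T θ e := fun θ e =>
    inner_planeRotation hu hw huw θ v e
  have hmR : ∀ θ e, m (sphereMap (R θ) e) = m e * Real.cos θ - p e * Real.sin θ := fun θ e =>
    wedge_planeRotation hu hw huw θ v e
  have hTmem : ∀ θ e, T θ e ∈ Set.Icc (-‖v‖) ‖v‖ := fun θ e => by
    rw [← hTR]; exact inner_mem_Icc v _
  have hTc : Continuous fun z : ℝ × 𝕊 => T z.1 z.2 := by fun_prop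
  have hψc : ContinuousOn ψ (Set.Icc (-‖v‖) ‖v‖) := fun s hs =>
    (hψ s hs).continuousAt.continuousWithinAt
  have hψT : Continuous fun z : ℝ × 𝕊 => ψ (T z.1 z.2) :=
    hψc.comp_continuous hTc fun z => hTmem z.1 z.2
  have hψ'T : Continuous fun z : ℝ × 𝕊 => ψ' (T z.1 z.2) :=
    hψ'.comp_continuous hTc fun z => hTmem z.1 z.2
  have hψt : Continuous fun e => ψ (t e) := hψc.comp_continuous ht fun e => inner_mem_Icc v e
  -- This is `m * ψ(t)` composed with the rotation, so its integral does not depend on `θ`. At `θ =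
  -- 0` the derivatives of `t` and `m` are `m` and `-p`, which yields the claimed integrand.
  let F : ℝ → 𝕊 → ℝ := fun θ e => (m e * Real.cos θ - p e * Real.sin θ) * ψ (T θ e)
  let F' : ℝ → 𝕊 → ℝ := fun θ e => (m e * (-Real.sin θ) - p e * Real.cos θ) * ψ (T θ e)
    + (m e * Real.cos θ - p e * Real.sin θ)
      * (ψ' (T θ e) * (-Real.sin θ * p e + Real.cos θ * m e))
  have hFc : Continuous fun z : ℝ × 𝕊 => F z.1 z.2 := by
    have : Continuous fun z : ℝ × 𝕊 => m z.2 * Real.cos z.1 - p z.2 * Real.sin z.1 := by fun_prop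
    exact this.mul hψT
  have hF'c : Continuous fun z : ℝ × 𝕊 => F' z.1 z.2 := by
    have h1 : Continuous fun z : ℝ × 𝕊 => m z.2 * Real.cos z.1 - p z.2 * Real.sin z.1 := by
      fun_prop
    have h2 : Continuous fun z : ℝ × 𝕊 => m z.2 * (-Real.sin z.1) - p z.2 * Real.cos z.1 := by
      fun_prop
    have h3 : Continuous fun z : ℝ × 𝕊 => -Real.sin z.1 * p z.2 + Real.cos z.1 * m z.2 := by
      fun_prop
    exact (h2.mul hψT).add (h1.mul (hψ'T.mul h3))
  have hderiv : ∀ θ e, HasDerivAt (fun x => F x e) (F' θ e) θ := fun θ e => by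
    have h1 : HasDerivAt (fun x => m e * Real.cos x - p e * Real.sin x)
        (m e * (-Real.sin θ) - p e * Real.cos θ) θ :=
      ((Real.hasDerivAt_cos θ).const_mul _).sub ((Real.hasDerivAt_sin θ).const_mul _)
    have h2 : HasDerivAt (fun x => T x e) (-Real.sin θ * p e + Real.cos θ * m e) θ :=
      ((((Real.hasDerivAt_cos θ).sub_const 1).mul_const _).const_add _).add
        ((Real.hasDerivAt_sin θ).mul_const _)
    exact h1.mul (((hψ _ (hTmem θ e)).comp θ h2))
  have key := hasDerivAt_integral_of_continuous (μ := σ) (F := F)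
    (fun θ => hFc.comp (Continuous.prodMk_right θ)) hF'c hderiv 0
  have hconst : (fun θ => ∫ e, F θ e ∂σ) = fun _ => ∫ e, m e * ψ (t e) ∂σ := by
    funext θ
    have h := integral_sphereMap (R θ) (G := fun e => m e * ψ (t e)) (hm.mul hψt)
    simpa only [hTR, hmR] using h
  rw [hconst] at key
  have h0 := key.unique (hasDerivAt_const _ _)
  rw [← h0]
  refine integral_congr_ae (Filter.Eventually.of_forall fun e => ?_)
  simp only [F', T, m, p, t, Real.cos_zero, Real.sin_zero]
  ring_nf

/-- The Laplace–Beltrami operator of the sphere annihilates the integral of a zonal function. -/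
theorem integral_zonal_eq_zero (v : E) {ψ ψ' : ℝ → ℝ}
    (hψ : ∀ t ∈ Set.Icc (-‖v‖) ‖v‖, HasDerivAt ψ (ψ' t) t)
    (hψ' : ContinuousOn ψ' (Set.Icc (-‖v‖) ‖v‖)) :
    ∫ e : 𝕊, ((‖v‖ ^ 2 - inner ℝ v (e : E) ^ 2) * ψ' (inner ℝ v (e : E))
      - (Module.finrank ℝ E - 1) * (inner ℝ v (e : E) * ψ (inner ℝ v (e : E)))) ∂σ = 0 := by
  let b := stdOrthonormalBasis ℝ E
  let f : Fin (Module.finrank ℝ E) → Fin (Module.finrank ℝ E) → 𝕊 → ℝ := fun i j e =>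
    (inner ℝ (b i) (e : E) * inner ℝ (b j) v - inner ℝ (b j) (e : E) * inner ℝ (b i) v) ^ 2
        * ψ' (inner ℝ v (e : E))
      - (inner ℝ (b i) (e : E) * inner ℝ (b i) v + inner ℝ (b j) (e : E) * inner ℝ (b j) v)
        * ψ (inner ℝ v (e : E))
  have hψc : ContinuousOn ψ (Set.Icc (-‖v‖) ‖v‖) := fun s hs =>
    (hψ s hs).continuousAt.continuousWithinAt
  have ht : Continuous fun e : 𝕊 => inner ℝ v (e : E) := by fun_prop
  have hψt : Continuous fun e : 𝕊 => ψ (inner ℝ v (e : E)) :=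
    hψc.comp_continuous ht fun e => inner_mem_Icc v e
  have hψ't : Continuous fun e : 𝕊 => ψ' (inner ℝ v (e : E)) :=
    hψ'.comp_continuous ht fun e => inner_mem_Icc v e
  have hf : ∀ i j, Continuous (f i j) := fun i j => by
    exact (Continuous.mul (by fun_prop) hψ't).sub (Continuous.mul (by fun_prop) hψt)
  have hzero : ∀ i j, i ≠ j → ∫ e, f i j e ∂σ = 0 := fun i j hij =>
    integral_plane_eq_zero (b.norm_eq_one i) (b.norm_eq_one j) (b.orthonormal.2 hij) v hψ hψ'
  -- Sum the plane identities over ordered pairs of distinct basis vectors. Lagrange's identity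
  -- turns the squared minors into `2 (‖v‖² - ⟨v, e⟩²)`; the other terms give `2 (n - 1) ⟨v, e⟩`.
  have hsum : ∫ e, ∑ i, ∑ j, (if i = j then 0 else f i j e) ∂σ = 0 := by
    have hite : ∀ i j, Continuous fun e => if i = j then 0 else f i j e := fun i j => by
      split_ifs
      · exact continuous_const
      · exact hf i j
    rw [integral_finsetSum _ fun i _ =>
      integrable_sphere (continuous_finsetSum _ fun j _ => hite i j)]
    refine Finset.sum_eq_zero fun i _ => ?_
    rw [integral_finsetSum _ fun j _ => integrable_sphere (hite i j)]
    refine Finset.sum_eq_zero fun j _ => ?_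
    split_ifs with hij
    · simp
    · exact hzero i j hij
  have hcalc : ∀ e : 𝕊, ∑ i, ∑ j, (if i = j then 0 else f i j e)
      = 2 * ((‖v‖ ^ 2 - inner ℝ v (e : E) ^ 2) * ψ' (inner ℝ v (e : E))
      - (Module.finrank ℝ E - 1) * (inner ℝ v (e : E) * ψ (inner ℝ v (e : E)))) := by
    intro e
    have hee : ∑ i, inner ℝ (b i) (e : E) * inner ℝ (b i) (e : E) = 1 := by
      have := b.sum_inner_mul_inner (e : E) (e : E)
      rw [real_inner_self_eq_norm_sq, norm_eq_of_mem_sphere e, one_pow] at this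
      refine Eq.trans (Finset.sum_congr rfl fun i _ => ?_) this
      rw [real_inner_comm (b i) (e : E)]
    have hvv : ∑ i, inner ℝ (b i) v * inner ℝ (b i) v = ‖v‖ ^ 2 := by
      rw [← real_inner_self_eq_norm_sq, ← b.sum_inner_mul_inner v v]
      exact Finset.sum_congr rfl fun i _ => by rw [real_inner_comm (b i) v]
    have hev : ∑ i, inner ℝ (b i) (e : E) * inner ℝ (b i) v = inner ℝ v (e : E) := by
      rw [← b.sum_inner_mul_inner v (e : E)]
      exact Finset.sum_congr rfl fun i _ => by rw [real_inner_comm (b i) v]; ring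
    have hdiag : ∀ i, ∑ j, (if i = j then 0 else f i j e) = ∑ j, f i j e - f i i e := fun i => by
      rw [← Finset.sum_erase_eq_sub (Finset.mem_univ i), ← Finset.sum_erase _ (a := i) (by simp)]
      exact Finset.sum_congr rfl fun j hj => if_neg (Finset.ne_of_mem_erase hj).symm
    have hrow : ∀ i, ∑ j, f i j e =
        (inner ℝ (b i) (e : E) * inner ℝ (b i) (e : E) * ‖v‖ ^ 2
          - 2 * (inner ℝ (b i) (e : E) * inner ℝ (b i) v) * inner ℝ v (e : E)
          + inner ℝ (b i) v * inner ℝ (b i) v) * ψ' (inner ℝ v (e : E))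
        - (Module.finrank ℝ E * (inner ℝ (b i) (e : E) * inner ℝ (b i) v) + inner ℝ v (e : E))
          * ψ (inner ℝ v (e : E)) := fun i => by
      have h1 : ∀ j, f i j e =
          (inner ℝ (b i) (e : E) * inner ℝ (b i) (e : E) * ψ' (inner ℝ v (e : E)))
            * (inner ℝ (b j) v * inner ℝ (b j) v)
          - (2 * (inner ℝ (b i) (e : E) * inner ℝ (b i) v) * ψ' (inner ℝ v (e : E))
             + ψ (inner ℝ v (e : E)))
            * (inner ℝ (b j) (e : E) * inner ℝ (b j) v)
          + (inner ℝ (b i) v * inner ℝ (b i) v * ψ' (inner ℝ v (e : E)))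
            * (inner ℝ (b j) (e : E) * inner ℝ (b j) (e : E))
          - (inner ℝ (b i) (e : E) * inner ℝ (b i) v) * ψ (inner ℝ v (e : E)) := fun j => by
        simp only [f]; ring
      simp only [h1, Finset.sum_sub_distrib, Finset.sum_add_distrib, ← Finset.mul_sum, hee, hvv,
        hev, Finset.sum_const, Finset.card_univ, Fintype.card_fin, nsmul_eq_mul]
      ring
    have hii : ∀ i, f i i e =
        -2 * ψ (inner ℝ v (e : E)) * (inner ℝ (b i) (e : E) * inner ℝ (b i) v) := fun i => by
      simp only [f]; ring
    have h2 : ∀ i, ∑ j, f i j e - f i i e =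
        (‖v‖ ^ 2 * ψ' (inner ℝ v (e : E))) * (inner ℝ (b i) (e : E) * inner ℝ (b i) (e : E))
          + (-2 * inner ℝ v (e : E) * ψ' (inner ℝ v (e : E))
            - (Module.finrank ℝ E - 2) * ψ (inner ℝ v (e : E)))
            * (inner ℝ (b i) (e : E) * inner ℝ (b i) v)
          + ψ' (inner ℝ v (e : E)) * (inner ℝ (b i) v * inner ℝ (b i) v)
          - inner ℝ v (e : E) * ψ (inner ℝ v (e : E)) := fun i => by
      rw [hrow, hii]; ring
    simp only [hdiag, h2, Finset.sum_sub_distrib, Finset.sum_add_distrib, ← Finset.mul_sum, hee,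
      hvv, hev, Finset.sum_const, Finset.card_univ, Fintype.card_fin, nsmul_eq_mul]
    ring
  simp only [hcalc] at hsum
  rw [integral_const_mul] at hsum
  linarith

theorem integral_inner_eq_zero (v : E) : ∫ e : 𝕊, inner ℝ v (e : E) ∂σ = 0 := by
  have h := integral_sphereMap (LinearIsometryEquiv.neg ℝ)
    (G := fun e : 𝕊 => inner ℝ v (e : E)) (by fun_prop)
  simp only [sphereMap, LinearIsometryEquiv.coe_neg, inner_neg_right, integral_neg] at h
  linarith

theorem finrank_mul_integral_inner_sq (v : E) :
    Module.finrank ℝ E * ∫ e : 𝕊, inner ℝ v (e : E) ^ 2 ∂σ = ‖v‖ ^ 2 * Measure.real σ Set.univ := by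
  have h := integral_zonal_eq_zero v (ψ := id) (ψ' := fun _ => 1) (fun t _ => hasDerivAt_id t)
    continuousOn_const
  have hrw : ∀ e : 𝕊, (‖v‖ ^ 2 - inner ℝ v (e : E) ^ 2) * 1
      - (Module.finrank ℝ E - 1) * (inner ℝ v (e : E) * id (inner ℝ v (e : E)))
      = ‖v‖ ^ 2 - Module.finrank ℝ E * inner ℝ v (e : E) ^ 2 := fun e => by
    simp only [id]; ring
  simp only [hrw] at h
  rw [integral_sub (integrable_const _) (integrable_sphere (by fun_prop)), integral_const,
    integral_const_mul, smul_eq_mul] at h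
  linarith

end Sphere

/-! ### Taylor bounds for negative powers -/

theorem one_sub_mul_le_rpow_neg {a u : ℝ} (ha : 0 ≤ a) (hu : -1 < u) :
    1 - a * u ≤ (1 + u) ^ (-a) := by
  have hpos : 0 < 1 + u := by linarith
  rw [Real.rpow_def_of_pos hpos]
  have h1 := Real.log_le_sub_one_of_pos hpos
  have h2 := Real.add_one_le_exp (Real.log (1 + u) * -a)
  nlinarith

theorem hasDerivAt_one_add_rpow_neg (a : ℝ) {u : ℝ} (hu : -1 < u) :
    HasDerivAt (fun u : ℝ => (1 + u) ^ (-a)) (-a * (1 + u) ^ (-(a + 1))) u := by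
  have h := ((hasDerivAt_id u).const_add 1).rpow_const (p := -a)
    (Or.inl (by simp only [id]; linarith))
  refine h.congr_deriv ?_
  simp only [id]
  rw [show -a - 1 = -(a + 1) by ring]
  ring

/-- The second order Taylor polynomial of `(1 + u) ^ (-a)` at `0` crosses it from below to above. -/
theorem antitoneOn_rpow_neg_sub_taylor_two {a : ℝ} (ha : 0 ≤ a) :
    AntitoneOn (fun u : ℝ => (1 + u) ^ (-a) - (1 - a * u + a * (a + 1) / 2 * u ^ 2))
      (Set.Ioi (-1)) := by
  have hd : ∀ u ∈ Set.Ioi (-1 : ℝ),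
      HasDerivAt (fun u : ℝ => (1 + u) ^ (-a) - (1 - a * u + a * (a + 1) / 2 * u ^ 2))
        (-a * ((1 + u) ^ (-(a + 1)) - (1 - (a + 1) * u))) u := fun u hu => by
    have h := (hasDerivAt_one_add_rpow_neg a hu).sub
      ((((hasDerivAt_id u).const_mul a).const_sub 1).add
        ((hasDerivAt_pow 2 u).const_mul (a * (a + 1) / 2)))
    refine h.congr_deriv ?_
    push_cast
    ring
  refine antitoneOn_of_hasDerivWithinAt_nonpos (convex_Ioi _)
    (fun u hu => (hd u hu).continuousAt.continuousWithinAt)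
    (fun u hu => (hd u (interior_subset hu)).hasDerivWithinAt) fun u hu => ?_
  have := one_sub_mul_le_rpow_neg (by linarith : 0 ≤ a + 1) (interior_subset hu)
  exact mul_nonpos_of_nonpos_of_nonneg (by linarith) (by linarith)

/-- The derivative of the remainder is `-a` times the second order remainder for exponent `a + 1`,
which is antitone and vanishes at `0`; so the cubic remainder has its minimum, `0`, at `0`. -/
theorem taylor_three_le_rpow_neg {a u : ℝ} (ha : 0 ≤ a) (hu : -1 < u) :
    1 - a * u + a * (a + 1) / 2 * u ^ 2 - a * (a + 1) * (a + 2) / 6 * u ^ 3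
      ≤ (1 + u) ^ (-a) := by
  let g : ℝ → ℝ := fun u => (1 + u) ^ (-a)
    - (1 - a * u + a * (a + 1) / 2 * u ^ 2 - a * (a + 1) * (a + 2) / 6 * u ^ 3)
  let h : ℝ → ℝ := fun u => (1 + u) ^ (-(a + 1))
    - (1 - (a + 1) * u + (a + 1) * (a + 1 + 1) / 2 * u ^ 2)
  have hd : ∀ u ∈ Set.Ioi (-1 : ℝ), HasDerivAt g (-a * h u) u := fun u hu => by
    have hg := (hasDerivAt_one_add_rpow_neg a hu).sub
      (((((hasDerivAt_id u).const_mul a).const_sub 1).add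
        ((hasDerivAt_pow 2 u).const_mul (a * (a + 1) / 2))).sub
        ((hasDerivAt_pow 3 u).const_mul (a * (a + 1) * (a + 2) / 6)))
    refine hg.congr_deriv ?_
    simp only [h]
    push_cast
    ring
  have hanti : AntitoneOn h (Set.Ioi (-1)) :=
    antitoneOn_rpow_neg_sub_taylor_two (by linarith : 0 ≤ a + 1)
  have h0 : h 0 = 0 := by simp [h]
  have g0 : g 0 = 0 := by simp [g]
  have hm1 : (-1 : ℝ) < 0 := by norm_num
  suffices 0 ≤ g u by simp only [g] at this; linarith
  rw [← g0]
  rcases le_total 0 u with h0u | hu0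
  · have hmono : MonotoneOn g (Set.Ici 0) := by
      have hsub : ∀ x ∈ Set.Ici (0 : ℝ), x ∈ Set.Ioi (-1 : ℝ) := fun x hx => hm1.trans_le hx
      refine monotoneOn_of_hasDerivWithinAt_nonneg (convex_Ici _)
        (fun x hx => (hd x (hsub x hx)).continuousAt.continuousWithinAt)
        (fun x hx => (hd x (hsub x (interior_subset hx))).hasDerivWithinAt) fun x hx => ?_
      have hx0 : x ∈ Set.Ici (0 : ℝ) := interior_subset hx
      have := hanti hm1 (hsub x hx0) hx0
      exact mul_nonneg_of_nonpos_of_nonpos (by linarith) (by linarith)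
    exact hmono Set.self_mem_Ici h0u h0u
  · have hmono : AntitoneOn g (Set.Ioc (-1) 0) := by
      refine antitoneOn_of_hasDerivWithinAt_nonpos (convex_Ioc _ _)
        (fun x hx => (hd x hx.1).continuousAt.continuousWithinAt)
        (fun x hx => (hd x (interior_subset hx).1).hasDerivWithinAt) fun x hx => ?_
      have hx0 : x ∈ Set.Ioc (-1 : ℝ) 0 := interior_subset hx
      have := hanti hx0.1 hm1 hx0.2
      exact mul_nonpos_of_nonpos_of_nonneg (by linarith) (by linarith)
    exact hmono ⟨hu, hu0⟩ ⟨hm1, le_rfl⟩ hu0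

/-! ### Spherical means of powers -/

section Sphere

variable {E : Type*} [NormedAddCommGroup E] [InnerProductSpace ℝ E] [FiniteDimensional ℝ E]
  [MeasurableSpace E] [BorelSpace E]

local notation "𝕊" => Metric.sphere (0 : E) 1

local notation "σ" => (Measure.toSphere (volume : Measure E))

theorem quadratic_pos {q r t b : ℝ} (hq : b ^ 2 < q) (ht : t ∈ Set.Icc (-b) b) :
    0 < q + 2 * r * t + r ^ 2 := by
  have h : t ^ 2 ≤ b ^ 2 := sq_le_sq' ht.1 ht.2
  nlinarith [sq_nonneg (r + t)]

/-- Spherical means of `x ↦ (‖x‖ ^ 2 + d) ^ (-a)`, which is smooth and superharmonic for `0 < d`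
and `2 * a ≤ n - 2`. -/
theorem integral_rpow_neg_le {v : E} {q a r : ℝ} (hq : ‖v‖ ^ 2 < q) (ha : 0 ≤ a)
    (han : 2 * a ≤ Module.finrank ℝ E - 2) (hr : 0 ≤ r) :
    ∫ e : 𝕊, (q + 2 * r * inner ℝ v (e : E) + r ^ 2) ^ (-a) ∂σ
      ≤ Measure.real σ Set.univ * q ^ (-a) := by
  set n := Module.finrank ℝ E
  have hn : 2 ≤ n := by
    have : (2 : ℝ) ≤ n := by linarith
    exact_mod_cast this
  let t : 𝕊 → ℝ := fun e => inner ℝ v (e : E)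
  let D : ℝ → 𝕊 → ℝ := fun r e => q + 2 * r * t e + r ^ 2
  have hD : ∀ r e, 0 < D r e := fun r e => quadratic_pos hq (inner_mem_Icc v e)
  have hDc : Continuous fun z : ℝ × 𝕊 => D z.1 z.2 := by fun_prop
  have hpow : ∀ s : ℝ, Continuous fun z : ℝ × 𝕊 => D z.1 z.2 ^ s := fun s =>
    hDc.rpow_const fun z => Or.inl (hD _ _).ne'
  have hDd : ∀ r e, HasDerivAt (fun x => D x e) (2 * r + 2 * t e) r := fun r e => by
    have h := (((hasDerivAt_id r).const_mul 2).mul_const (t e)).const_add q |>.add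
      (hasDerivAt_pow 2 r)
    refine h.congr_deriv ?_
    push_cast
    ring
  have hpd : ∀ (s : ℝ) r e, HasDerivAt (fun x => D x e ^ s)
      ((2 * r + 2 * t e) * s * D r e ^ (s - 1)) r := fun s r e =>
    (hDd r e).rpow_const (Or.inl (hD r e).ne')
  let F : ℝ → 𝕊 → ℝ := fun r e => D r e ^ (-a)
  let F₁ : ℝ → 𝕊 → ℝ := fun r e => (2 * r + 2 * t e) * (-a * D r e ^ (-a - 1))
  let F₂ : ℝ → 𝕊 → ℝ := fun r e => 2 * (-a * D r e ^ (-a - 1))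
    + (2 * r + 2 * t e) * (-a * ((2 * r + 2 * t e) * (-a - 1) * D r e ^ (-a - 2)))
  have hlin : Continuous fun z : ℝ × 𝕊 => 2 * z.1 + 2 * t z.2 := by fun_prop
  have hFc : Continuous fun z : ℝ × 𝕊 => F z.1 z.2 := hpow _
  have hF₁c : Continuous fun z : ℝ × 𝕊 => F₁ z.1 z.2 :=
    hlin.mul (continuous_const.mul (hpow _))
  have hF₂c : Continuous fun z : ℝ × 𝕊 => F₂ z.1 z.2 :=
    (continuous_const.mul (continuous_const.mul (hpow _))).add
      (hlin.mul (continuous_const.mul ((hlin.mul continuous_const).mul (hpow _))))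
  have hs : ∀ {G : ℝ → 𝕊 → ℝ}, (Continuous fun z : ℝ × 𝕊 => G z.1 z.2) → ∀ r, Continuous (G r) :=
    fun hG r => hG.comp (Continuous.prodMk_right r)
  have hH : ∀ r, HasDerivAt (fun x => ∫ e, F x e ∂σ) (∫ e, F₁ r e ∂σ) r :=
    hasDerivAt_integral_of_continuous (hs hFc) hF₁c fun r e => by
      refine (hpd (-a) r e).congr_deriv ?_
      simp only [F₁]
      ring
  have hH₁ : ∀ r, HasDerivAt (fun x => ∫ e, F₁ x e ∂σ) (∫ e, F₂ r e ∂σ) r :=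
    hasDerivAt_integral_of_continuous (hs hF₁c) hF₂c fun r e => by
      have h1 : HasDerivAt (fun x => 2 * x + 2 * t e) 2 r := by
        simpa using ((hasDerivAt_id r).const_mul 2).add_const (2 * t e)
      have h2 := h1.mul ((hpd (-a - 1) r e).const_mul (-a))
      rw [show -a - 1 - 1 = -a - 2 by ring] at h2
      exact h2
  -- Radial form of the Laplacian, times `r`. Adding `-2 a` times the zonal identity, which
  -- integrates to `0`, turns the integrand into `r` times the full Laplacian of `(‖x‖² + d) ^
  -- (-a)`, nonpositive at every point.
  have hrad : ∀ r, 0 ≤ r → (n - 1) * (∫ e, F₁ r e ∂σ) + r * ∫ e, F₂ r e ∂σ ≤ 0 := by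
    intro r hr
    have hDt : ∀ x ∈ Set.Icc (-‖v‖) ‖v‖, q + 2 * r * x + r ^ 2 ≠ 0 := fun x hx =>
      (quadratic_pos hq hx).ne'
    have hz := integral_zonal_eq_zero v
      (ψ := fun x => (q + 2 * r * x + r ^ 2) ^ (-a - 1))
      (ψ' := fun x => 2 * r * (-a - 1) * (q + 2 * r * x + r ^ 2) ^ (-a - 2))
      (fun x hx => by
        have h := ((((hasDerivAt_id x).const_mul (2 * r)).const_add q).add_const
          (r ^ 2)).rpow_const (p := -a - 1) (Or.inl (hDt x hx))
        rw [show -a - 1 - 1 = -a - 2 by ring, mul_one] at h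
        exact h)
      (continuousOn_const.mul (ContinuousOn.rpow_const (by fun_prop)
        fun x hx => Or.inl (hDt x hx)))
    let Z : 𝕊 → ℝ := fun e => (‖v‖ ^ 2 - t e ^ 2) * (2 * r * (-a - 1) * D r e ^ (-a - 2))
      - (n - 1) * (t e * D r e ^ (-a - 1))
    have ht : Continuous t := by fun_prop
    have hDr : ∀ s : ℝ, Continuous fun e => D r e ^ s := fun s =>
      (hpow s).comp (Continuous.prodMk_right r)
    have hZc : Continuous Z :=
      ((continuous_const.sub (ht.pow 2)).mul (continuous_const.mul (hDr _))).sub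
        (continuous_const.mul (ht.mul (hDr _)))
    have hZ0 : ∫ e, Z e ∂σ = 0 := hz
    have i1 := (integrable_sphere (hs hF₁c r)).const_mul ((n : ℝ) - 1)
    have i2 := (integrable_sphere (hs hF₂c r)).const_mul r
    have i3 := (integrable_sphere hZc).const_mul (-(2 * a))
    have heq : (n - 1) * (∫ e, F₁ r e ∂σ) + r * ∫ e, F₂ r e ∂σ
        = ∫ e, ((n - 1) * F₁ r e + r * F₂ r e + -(2 * a) * Z e) ∂σ := by
      have i12 : Integrable (fun e => (n - 1) * F₁ r e + r * F₂ r e) σ := i1.add i2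
      rw [integral_add i12 i3, integral_add i1 i2, integral_const_mul, integral_const_mul,
        integral_const_mul, hZ0]
      ring
    rw [heq]
    refine integral_nonpos fun e => ?_
    have hmul : D r e ^ (-a - 1) = D r e ^ (-a - 2) * D r e := by
      rw [← Real.rpow_add_one (hD r e).ne']
      congr 1
      ring
    have hval : (n - 1) * F₁ r e + r * F₂ r e + -(2 * a) * Z e
        = -(2 * a * r * D r e ^ (-a - 2))
          * ((n - 2 - 2 * a) * D r e + 2 * (a + 1) * (q - ‖v‖ ^ 2)) := by
      simp only [F₁, F₂, Z, hmul]
      simp only [D]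
      ring
    simp only [Pi.zero_apply]
    rw [hval]
    refine mul_nonpos_of_nonpos_of_nonneg ?_ ?_
    · have := (Real.rpow_pos_of_pos (hD r e) (-a - 2)).le
      have : 0 ≤ 2 * a * r * D r e ^ (-a - 2) := by positivity
      linarith
    · have := (hD r e).le
      exact add_nonneg (mul_nonneg (by linarith) this) (mul_nonneg (by linarith) (by linarith))
  have hWd : ∀ r, HasDerivAt (fun x => x ^ (n - 1) * ∫ e, F₁ x e ∂σ)
      (r ^ (n - 2) * ((n - 1) * (∫ e, F₁ r e ∂σ) + r * ∫ e, F₂ r e ∂σ)) r := fun r => by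
    have h := (hasDerivAt_pow (n - 1) r).mul (hH₁ r)
    refine h.congr_deriv ?_
    have h1 : n - 1 - 1 = n - 2 := by omega
    have h2 : n - 1 = n - 2 + 1 := by omega
    rw [h1]
    have h3 : r ^ (n - 1) = r ^ (n - 2) * r := by rw [h2, pow_succ]
    rw [h3, Nat.cast_sub (by omega), Nat.cast_one]
    ring
  have hW : AntitoneOn (fun x => x ^ (n - 1) * ∫ e, F₁ x e ∂σ) (Set.Ici 0) :=
    antitoneOn_of_hasDerivWithinAt_nonpos (convex_Ici 0)
      (fun x _ => (hWd x).continuousAt.continuousWithinAt)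
      (fun x _ => (hWd x).hasDerivWithinAt) fun x hx => by
        have hx0 : (0 : ℝ) ≤ x := interior_subset hx
        exact mul_nonpos_of_nonneg_of_nonpos (pow_nonneg hx0 _) (hrad x hx0)
  -- Since `n ≥ 2`, the factor `x ^ (n - 1)` vanishes at `0`, so the antitone product is
  -- nonpositive.
  have hH₁neg : ∀ x, 0 < x → ∫ e, F₁ x e ∂σ ≤ 0 := fun x hx => by
    have h := hW Set.self_mem_Ici hx.le hx.le
    simp only [zero_pow (by omega : n - 1 ≠ 0), zero_mul] at h
    exact nonpos_of_mul_nonpos_right h (pow_pos hx _)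
  have hHanti : AntitoneOn (fun x => ∫ e, F x e ∂σ) (Set.Ici 0) :=
    antitoneOn_of_hasDerivWithinAt_nonpos (convex_Ici 0)
      (fun x _ => (hH x).continuousAt.continuousWithinAt)
      (fun x _ => (hH x).hasDerivWithinAt) fun x hx => by
        rw [interior_Ici] at hx
        exact hH₁neg x hx
  have h := hHanti Set.self_mem_Ici hr hr
  simpa [F, D, t] using h

/-- Replacing `q` by `q + 1 / (k + 1)` restores the strict inequality and removes the singularity;
Fatou's lemma passes to the limit, and the right-hand side only grows as the shift is dropped. -/
theorem lintegral_rpow_neg_le {v : E} {q a r : ℝ} (hq : ‖v‖ ^ 2 ≤ q) (ha : 0 ≤ a)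
    (han : 2 * a ≤ Module.finrank ℝ E - 2) (hr : 0 ≤ r) :
    ∫⁻ e : 𝕊, ENNReal.ofReal (q + 2 * r * inner ℝ v (e : E) + r ^ 2) ^ (-a) ∂σ
      ≤ σ Set.univ * ENNReal.ofReal q ^ (-a) := by
  let d : ℕ → ℝ := fun k => 1 / ((k : ℝ) + 1)
  have hd0 : ∀ k, 0 < d k := fun k => by positivity
  let f : ℕ → 𝕊 → ℝ≥0∞ := fun k e =>
    ENNReal.ofReal (q + d k + 2 * r * inner ℝ v (e : E) + r ^ 2) ^ (-a)
  have hlim : ∀ e : 𝕊, Filter.Tendsto (fun k => f k e) Filter.atTop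
      (nhds (ENNReal.ofReal (q + 2 * r * inner ℝ v (e : E) + r ^ 2) ^ (-a))) := fun e => by
    have hc : Continuous fun x : ℝ =>
        ENNReal.ofReal (q + x + 2 * r * inner ℝ v (e : E) + r ^ 2) ^ (-a) :=
      ENNReal.continuous_rpow_const.comp (ENNReal.continuous_ofReal.comp (by fun_prop))
    have := (hc.tendsto 0).comp tendsto_one_div_add_atTop_nhds_zero_nat
    simpa [f, d, Function.comp_def] using this
  have hmeas : ∀ k, Measurable (f k) := fun k =>
    (ENNReal.continuous_rpow_const.comp (ENNReal.continuous_ofReal.comp (by fun_prop))).measurable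
  have hbound : ∀ k, ∫⁻ e, f k e ∂σ ≤ σ Set.univ * ENNReal.ofReal q ^ (-a) := fun k => by
    have hqk : ‖v‖ ^ 2 < q + d k := by linarith [hd0 k]
    have hqpos : 0 < q + d k := lt_of_le_of_lt (sq_nonneg _) hqk
    have hpos : ∀ e : 𝕊, 0 < q + d k + 2 * r * inner ℝ v (e : E) + r ^ 2 := fun e =>
      quadratic_pos hqk (inner_mem_Icc v e)
    have hc : Continuous fun e : 𝕊 => (q + d k + 2 * r * inner ℝ v (e : E) + r ^ 2) ^ (-a) :=
      Continuous.rpow_const (by fun_prop) fun e => Or.inl (hpos e).ne'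
    have h1 : ∫⁻ e, f k e ∂σ = ENNReal.ofReal
        (∫ e : 𝕊, (q + d k + 2 * r * inner ℝ v (e : E) + r ^ 2) ^ (-a) ∂σ) := by
      rw [ofReal_integral_eq_lintegral_ofReal (integrable_sphere hc)
        (Filter.Eventually.of_forall fun e => Real.rpow_nonneg (hpos e).le _)]
      exact lintegral_congr fun e => ENNReal.ofReal_rpow_of_pos (hpos e)
    rw [h1]
    refine (ENNReal.ofReal_le_ofReal (integral_rpow_neg_le hqk ha han hr)).trans ?_
    rw [ENNReal.ofReal_mul measureReal_nonneg, ofReal_measureReal,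
      ← ENNReal.ofReal_rpow_of_pos hqpos, ENNReal.rpow_neg, ENNReal.rpow_neg]
    gcongr
    linarith [hd0 k]
  calc ∫⁻ e : 𝕊, ENNReal.ofReal (q + 2 * r * inner ℝ v (e : E) + r ^ 2) ^ (-a) ∂σ
      = ∫⁻ e, Filter.liminf (fun k => f k e) Filter.atTop ∂σ :=
        lintegral_congr fun e => (hlim e).liminf_eq.symm
    _ ≤ Filter.liminf (fun k => ∫⁻ e, f k e ∂σ) Filter.atTop := lintegral_liminf_le hmeas
    _ ≤ _ := Filter.liminf_le_of_le (by isBoundedDefault) fun b hb => by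
        obtain ⟨k, hk⟩ := hb.exists
        exact hk.trans (hbound k)

theorem exists_lt_lintegral_rpow_neg [Nontrivial E] {v : E} (hv : ‖v‖ = 1) {a : ℝ} (ha : 0 < a)
    (han : (Module.finrank ℝ E : ℝ) - 2 < 2 * a) :
    ∃ r : ℝ, 0 < r ∧ σ Set.univ
      < ∫⁻ e : 𝕊, ENNReal.ofReal (1 + 2 * r * inner ℝ v (e : E) + r ^ 2) ^ (-a) ∂σ := by
  set n := Module.finrank ℝ E with hn_def
  have hn : (0 : ℝ) < n := by exact_mod_cast (Module.finrank_pos (R := ℝ) (M := E))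
  -- `δ` is the `r²` coefficient `-a + 2 a (a + 1) / n` of the mean, and `K` the size of the cubic
  -- Taylor coefficient. As `r ≤ 1/2`, the increment `u = 2 r t + r²` satisfies `-1 < u ≤ 3 r`, so
  -- the cubic term costs at most `27 K r³`, which the second bound on `r` keeps below `δ r²`.
  let δ : ℝ := a * (2 * a + 2 - n) / n
  let K : ℝ := a * (a + 1) * (a + 2) / 6
  have hδ : 0 < δ := div_pos (mul_pos ha (by linarith)) hn
  have hK : 0 < K := by positivity
  let r : ℝ := min (1 / 2) (δ / (54 * K))
  have hr0 : 0 < r := lt_min (by norm_num) (by positivity)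
  have hr1 : r ≤ 1 / 2 := min_le_left _ _
  have hrK : 27 * K * r < δ := by
    have : r ≤ δ / (54 * K) := min_le_right _ _
    rw [le_div_iff₀ (by positivity)] at this
    nlinarith
  refine ⟨r, hr0, ?_⟩
  let t : 𝕊 → ℝ := fun e => inner ℝ v (e : E)
  have ht : ∀ e, t e ∈ Set.Icc (-1) 1 := fun e => by rw [← hv]; exact inner_mem_Icc v e
  have htc : Continuous t := by fun_prop
  have hu : ∀ e, -1 < 2 * r * t e + r ^ 2 := fun e => by
    nlinarith [mul_nonneg hr0.le (by linarith [(ht e).1] : 0 ≤ t e + 1)]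
  have hc : Continuous fun e : 𝕊 => (1 + 2 * r * t e + r ^ 2) ^ (-a) :=
    Continuous.rpow_const (by fun_prop) fun e => Or.inl (by linarith [hu e])
  have h1 : ∫⁻ e : 𝕊, ENNReal.ofReal (1 + 2 * r * inner ℝ v (e : E) + r ^ 2) ^ (-a) ∂σ
      = ENNReal.ofReal (∫ e : 𝕊, (1 + 2 * r * t e + r ^ 2) ^ (-a) ∂σ) := by
    rw [ofReal_integral_eq_lintegral_ofReal (integrable_sphere hc)
      (Filter.Eventually.of_forall fun e => Real.rpow_nonneg (by linarith [hu e]) _)]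
    exact lintegral_congr fun e => ENNReal.ofReal_rpow_of_pos (by linarith [hu e])
  have hΩ : 0 < Measure.real σ Set.univ := by
    rw [measureReal_def]
    exact ENNReal.toReal_pos (Measure.measure_univ_ne_zero.2 (Measure.toSphere_ne_zero _))
      (measure_ne_top _ _)
  rw [h1, ← ofReal_measureReal (μ := σ) (s := Set.univ)]
  refine (ENNReal.ofReal_lt_ofReal_iff_of_nonneg hΩ.le).2 ?_
  have hlow : ∀ e, (1 - a * r ^ 2 - 27 * K * r ^ 3)
      + (-(2 * a * r) + 2 * a * (a + 1) * r ^ 3) * t e + 2 * a * (a + 1) * r ^ 2 * t e ^ 2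
      ≤ (1 + 2 * r * t e + r ^ 2) ^ (-a) := fun e => by
    have h := taylor_three_le_rpow_neg ha.le (hu e)
    rw [← add_assoc] at h
    refine le_trans ?_ h
    have h3 : (2 * r * t e + r ^ 2) ^ 3 ≤ (3 * r) ^ 3 := by
      have : 2 * r * t e + r ^ 2 ≤ 3 * r := by
        nlinarith [mul_nonneg hr0.le (by linarith [(ht e).2] : 0 ≤ 1 - t e)]
      exact (Odd.strictMono_pow (by decide : Odd 3)).monotone this
    have h4 : K * (2 * r * t e + r ^ 2) ^ 3 ≤ K * (3 * r) ^ 3 :=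
      mul_le_mul_of_nonneg_left h3 hK.le
    have h5 : 0 ≤ a * (a + 1) / 2 * r ^ 4 := by positivity
    have h6 : a * (a + 1) * (a + 2) / 6 = K := rfl
    rw [h6]
    nlinarith
  have hint : ∫ e, ((1 - a * r ^ 2 - 27 * K * r ^ 3)
      + (-(2 * a * r) + 2 * a * (a + 1) * r ^ 3) * t e + 2 * a * (a + 1) * r ^ 2 * t e ^ 2) ∂σ
      = Measure.real σ Set.univ * (1 + r ^ 2 * (δ - 27 * K * r)) := by
    have hsq : ∫ e, t e ^ 2 ∂σ = Measure.real σ Set.univ / n := by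
      have := finrank_mul_integral_inner_sq v
      rw [hv, one_pow, one_mul] at this
      rw [eq_div_iff hn.ne', mul_comm]
      exact this
    have h0 : ∫ e, t e ∂σ = 0 := integral_inner_eq_zero v
    rw [integral_add (integrable_sphere (by fun_prop)) (integrable_sphere (by fun_prop)),
      integral_add (integrable_sphere (by fun_prop)) (integrable_sphere (by fun_prop)),
      integral_const, integral_const_mul, integral_const_mul, h0, hsq, smul_eq_mul]
    simp only [δ]
    field_simp
    ring
  refine lt_of_lt_of_le ?_ (hint.symm.le.trans (integral_mono
    (integrable_sphere (by fun_prop)) (integrable_sphere hc) hlow))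
  have : 0 < r ^ 2 * (δ - 27 * K * r) := by
    have : 0 < δ - 27 * K * r := by linarith
    positivity
  nlinarith

end Sphere

/-! ### Reduction from matrices to spheres in `ℝⁿ` -/

section Matrix

variable {n p : ℕ}

/-- Removes the square root; the values at `M = 0` agree because `ENNReal.rpow` has the same
conventions at base `0` for both exponents. -/
theorem frobeniusPower_eq (c : ℝ) (M : Matrix (Fin n) (Fin p) ℝ) :
    frobeniusPower (-c) M = ((ENNReal.ofReal (∑ i, ∑ j, M i j ^ 2) ^ (-(c / 2)) : ℝ≥0∞) : EReal) := by
  have h0 : 0 ≤ ∑ i, ∑ j, M i j ^ 2 :=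
    Finset.sum_nonneg fun i _ => Finset.sum_nonneg fun j _ => sq_nonneg _
  have h1 : frobeniusNorm M = (∑ i, ∑ j, M i j ^ 2) ^ (1 / 2 : ℝ) := by
    unfold frobeniusNorm
    rw [Matrix.frobenius_norm_def]
    simp [Real.rpow_ofNat]
  rw [frobeniusPower, h1, ← ENNReal.ofReal_rpow_of_nonneg h0 (by norm_num), ← ENNReal.rpow_mul]
  congr 2
  ring

theorem continuous_frobeniusPower (c : ℝ) :
    Continuous fun M : Matrix (Fin n) (Fin p) ℝ => frobeniusPower (-c) M := by
  simp only [frobeniusPower_eq]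
  refine continuous_coe_ennreal_ereal.comp (ENNReal.continuous_rpow_const.comp
    (ENNReal.continuous_ofReal.comp ?_))
  exact continuous_finsetSum _ fun i _ => continuous_finsetSum _ fun j _ =>
    (continuous_id.matrix_elem i j).pow 2

theorem sphereAverage_coe (g : Metric.sphere (0 : EuclideanSpace ℝ (Fin n)) 1 → ℝ≥0∞) :
    sphereAverage (fun e => (g e : EReal))
      = (((∫⁻ e, g e ∂(surfaceMeasure n)) / surfaceMeasure n Set.univ : ℝ≥0∞) : EReal) := by
  have h : ∀ e, (-(g e : EReal)).toENNReal = 0 := fun e =>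
    EReal.toENNReal_of_nonpos (by simpa using EReal.coe_ennreal_nonneg (g e))
  simp only [sphereAverage, h, EReal.toENNReal_coe, lintegral_zero, ENNReal.zero_div,
    EReal.coe_ennreal_zero, sub_zero]

theorem surfaceMeasure_univ_ne_zero (hn : 1 ≤ n) : surfaceMeasure n Set.univ ≠ 0 := by
  have : Nonempty (Fin n) := ⟨⟨0, hn⟩⟩
  exact Measure.measure_univ_ne_zero.2 (Measure.toSphere_ne_zero _)

theorem surfaceMeasure_univ_ne_top : surfaceMeasure n Set.univ ≠ ⊤ := by
  unfold surfaceMeasure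
  exact measure_ne_top _ _

/-- The vector `X ρ`, divided by the norm of `ρ` unless `ρ = 0`. -/
noncomputable def directionVector (X : Matrix (Fin n) (Fin p) ℝ) (ρ : Fin p → ℝ) :
    EuclideanSpace ℝ (Fin n) :=
  (√(∑ j, ρ j ^ 2))⁻¹ • WithLp.toLp 2 (X.mulVec ρ)

theorem sum_sq_add_vecMulVec (X : Matrix (Fin n) (Fin p) ℝ) (ρ : Fin p → ℝ)
    (e : Metric.sphere (0 : EuclideanSpace ℝ (Fin n)) 1) :
    ∑ i, ∑ j, (X + Matrix.vecMulVec (fun a => (e : EuclideanSpace ℝ (Fin n)) a) ρ) i j ^ 2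
      = ∑ i, ∑ j, X i j ^ 2
        + 2 * √(∑ j, ρ j ^ 2)
          * inner ℝ (directionVector X ρ) (e : EuclideanSpace ℝ (Fin n))
        + √(∑ j, ρ j ^ 2) ^ 2 := by
  have he : ∑ i, (e : EuclideanSpace ℝ (Fin n)) i ^ 2 = 1 := by
    rw [← EuclideanSpace.real_norm_sq_eq, norm_eq_of_mem_sphere e, one_pow]
  have hρ0 : 0 ≤ ∑ j, ρ j ^ 2 := Finset.sum_nonneg fun j _ => sq_nonneg _
  have hin : √(∑ j, ρ j ^ 2) * inner ℝ (directionVector X ρ) (e : EuclideanSpace ℝ (Fin n))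
      = ∑ i, ∑ j, X i j * ((e : EuclideanSpace ℝ (Fin n)) i * ρ j) := by
    have hbase : inner ℝ (WithLp.toLp 2 (X.mulVec ρ)) (e : EuclideanSpace ℝ (Fin n))
        = ∑ i, ∑ j, X i j * ((e : EuclideanSpace ℝ (Fin n)) i * ρ j) := by
      rw [PiLp.inner_apply]
      refine Finset.sum_congr rfl fun i _ => ?_
      simp only [Matrix.mulVec, dotProduct, RCLike.inner_apply, conj_trivial, Finset.mul_sum]
      exact Finset.sum_congr rfl fun j _ => by ring
    rcases hρ0.eq_or_lt with h | h
    · have hρ : ∀ j, ρ j = 0 := fun j => by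
        have := (Finset.sum_eq_zero_iff_of_nonneg fun j _ => sq_nonneg (ρ j)).1 h.symm j
          (Finset.mem_univ j)
        exact pow_eq_zero_iff two_ne_zero |>.1 this
      simp [hρ]
    · rw [directionVector, inner_smul_left, hbase, conj_trivial,
        mul_inv_cancel_left₀ (Real.sqrt_pos.2 h).ne']
  rw [mul_assoc, hin, Real.sq_sqrt hρ0]
  have hsq : ∑ i, ∑ j, ((e : EuclideanSpace ℝ (Fin n)) i * ρ j) ^ 2 = ∑ j, ρ j ^ 2 := by
    simp only [mul_pow, ← Finset.mul_sum]
    rw [← Finset.sum_mul, he, one_mul]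
  rw [← hsq]
  simp only [Finset.mul_sum, ← Finset.sum_add_distrib, Matrix.add_apply, Matrix.vecMulVec_apply]
  exact Finset.sum_congr rfl fun i _ => Finset.sum_congr rfl fun j _ => by ring

theorem norm_directionVector_sq_le (X : Matrix (Fin n) (Fin p) ℝ) (ρ : Fin p → ℝ) :
    ‖directionVector X ρ‖ ^ 2 ≤ ∑ i, ∑ j, X i j ^ 2 := by
  have hρ0 : 0 ≤ ∑ j, ρ j ^ 2 := Finset.sum_nonneg fun j _ => sq_nonneg _
  have hX0 : 0 ≤ ∑ i, ∑ j, X i j ^ 2 :=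
    Finset.sum_nonneg fun i _ => Finset.sum_nonneg fun j _ => sq_nonneg _
  rw [directionVector, norm_smul, mul_pow, norm_inv, inv_pow, Real.norm_eq_abs, sq_abs,
    Real.sq_sqrt hρ0, EuclideanSpace.real_norm_sq_eq]
  have h : ∑ i, X.mulVec ρ i ^ 2 ≤ (∑ i, ∑ j, X i j ^ 2) * ∑ j, ρ j ^ 2 := by
    rw [Finset.sum_mul]
    exact Finset.sum_le_sum fun i _ => Finset.sum_mul_sq_le_sq_mul_sq Finset.univ (X i) ρ
  -- For `ρ = 0` the convention `0⁻¹ = 0` makes the left side zero; otherwise the row-wise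
  -- Cauchy–Schwarz bound is divided by `‖ρ‖²`.
  rcases hρ0.eq_or_lt with h0 | h0
  · rw [← h0, inv_zero, zero_mul]
    exact hX0
  · rw [inv_mul_le_iff₀ h0, mul_comm]
    exact h

theorem rankOneAverage_frobeniusPower_le_iff (hn : 1 ≤ n) (c : ℝ) (X : Matrix (Fin n) (Fin p) ℝ)
    (ρ : Fin p → ℝ) :
    rankOneAverage (fun M => frobeniusPower (-c) M) X ρ ≤ frobeniusPower (-c) X ↔
      ∫⁻ e : Metric.sphere (0 : EuclideanSpace ℝ (Fin n)) 1,
          ENNReal.ofReal (∑ i, ∑ j, X i j ^ 2 + 2 * √(∑ j, ρ j ^ 2)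
            * inner ℝ (directionVector X ρ) (e : EuclideanSpace ℝ (Fin n))
            + √(∑ j, ρ j ^ 2) ^ 2) ^ (-(c / 2))
          ∂(volume : Measure (EuclideanSpace ℝ (Fin n))).toSphere
        ≤ (volume : Measure (EuclideanSpace ℝ (Fin n))).toSphere Set.univ
          * ENNReal.ofReal (∑ i, ∑ j, X i j ^ 2) ^ (-(c / 2)) := by
  simp only [rankOneAverage, frobeniusPower_eq, sphereAverage_coe, sum_sq_add_vecMulVec]
  rw [EReal.coe_ennreal_le_coe_ennreal_iff,
    ENNReal.div_le_iff (surfaceMeasure_univ_ne_zero hn) surfaceMeasure_univ_ne_top,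
    mul_comm (_ ^ _)]
  rfl

theorem exists_frobeniusPower_ne_top (hn : 1 ≤ n) (hp : 1 ≤ p) (c : ℝ) :
    ∃ M : Matrix (Fin n) (Fin p) ℝ, frobeniusPower (-c) M ≠ ⊤ := by
  refine ⟨Matrix.of fun _ _ => 1, ?_⟩
  have hpos : 0 < ∑ _i : Fin n, ∑ _j : Fin p, (1 : ℝ) ^ 2 := by
    simp only [one_pow, Finset.sum_const, Finset.card_univ, Fintype.card_fin, nsmul_eq_mul]
    have : (0 : ℝ) < n := by exact_mod_cast hn
    have : (0 : ℝ) < p := by exact_mod_cast hp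
    positivity
  rw [frobeniusPower_eq, Ne, EReal.coe_ennreal_eq_top_iff]
  simp only [Matrix.of_apply]
  rw [ENNReal.ofReal_rpow_of_pos hpos]
  exact ENNReal.ofReal_ne_top

theorem isMatrixSuperharmonic_frobeniusPower (hn : 1 ≤ n) (hp : 1 ≤ p) {c : ℝ} (hc : 0 ≤ c)
    (hcn : c ≤ n - 2) :
    IsMatrixSuperharmonic (fun M : Matrix (Fin n) (Fin p) ℝ => frobeniusPower (-c) M) where
  ne_bot X := by simp [frobeniusPower]
  lowerSemicontinuous := (continuous_frobeniusPower c).lowerSemicontinuous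
  exists_ne_top := exists_frobeniusPower_ne_top hn hp c
  average_le X ρ := by
    rw [rankOneAverage_frobeniusPower_le_iff hn]
    refine lintegral_rpow_neg_le (norm_directionVector_sq_le X ρ) (by positivity) ?_
      (Real.sqrt_nonneg _)
    rw [finrank_euclideanSpace_fin]
    linarith

theorem not_isMatrixSuperharmonic_frobeniusPower (hn : 1 ≤ n) (hp : 1 ≤ p) {c : ℝ} (hc : 0 < c)
    (hcn : n - 2 < c) :
    ¬ IsMatrixSuperharmonic (fun M : Matrix (Fin n) (Fin p) ℝ => frobeniusPower (-c) M) := by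
  intro h
  have : Nonempty (Fin n) := ⟨⟨0, hn⟩⟩
  let i₀ : Fin n := ⟨0, hn⟩
  let j₀ : Fin p := ⟨0, hp⟩
  let v : EuclideanSpace ℝ (Fin n) := EuclideanSpace.single i₀ 1
  have hv : ‖v‖ = 1 := by simp [v]
  obtain ⟨r, hr0, hr⟩ := exists_lt_lintegral_rpow_neg hv (a := c / 2) (by positivity)
    (by rw [finrank_euclideanSpace_fin]; linarith)
  -- Taking `ρ` along the row direction of this rank-one matrix gives equality in Cauchy–Schwarz, so
  -- `d = 0`.
  let X : Matrix (Fin n) (Fin p) ℝ := Matrix.vecMulVec v (Pi.single j₀ 1)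
  have hρ : √(∑ j, (Pi.single j₀ r : Fin p → ℝ) j ^ 2) = r := by
    have : ∑ j, (Pi.single j₀ r : Fin p → ℝ) j ^ 2 = r ^ 2 := by
      rw [Finset.sum_eq_single j₀ (fun j _ hj => by simp [hj]) (by simp), Pi.single_eq_same]
    rw [this, Real.sqrt_sq hr0.le]
  have hX : ∑ i, ∑ j, X i j ^ 2 = 1 := by
    have : ∀ i, ∑ j, X i j ^ 2 = v i ^ 2 := fun i => by
      rw [Finset.sum_eq_single j₀ (fun j _ hj => by simp [X, Matrix.vecMulVec_apply, hj]) (by simp)]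
      simp [X, Matrix.vecMulVec_apply]
    simp only [this]
    rw [← EuclideanSpace.real_norm_sq_eq, hv, one_pow]
  have hdir : directionVector X (Pi.single j₀ r) = v := by
    rw [directionVector, hρ]
    ext i
    simp [X, Matrix.vecMulVec_apply, hr0.ne']
  have hle := (rankOneAverage_frobeniusPower_le_iff hn c X (Pi.single j₀ r)).1 (h.average_le X _)
  rw [hρ, hX, hdir, ENNReal.ofReal_one, ENNReal.one_rpow, mul_one] at hle
  exact hr.not_ge hle

end Matrix

end MatrixSH

theorem mainTheorem9 (n p : ℕ) (hn : 1 ≤ n) (hp : 1 ≤ p) :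
    (∀ c : ℝ, 0 ≤ c → ¬ (n = 1 ∧ c = 0) →
      (MatrixSH.IsMatrixSuperharmonic
          (fun M : Matrix (Fin n) (Fin p) ℝ => MatrixSH.frobeniusPower (-c) M) ↔
        0 ≤ c ∧ c ≤ (n : ℝ) - 2)) ∧
    (2 ≤ p → ¬ (n = 1 ∧ p = 2) →
      ¬ MatrixSH.IsMatrixSuperharmonic
          (fun M : Matrix (Fin n) (Fin p) ℝ =>
            MatrixSH.frobeniusPower (2 - (n : ℝ) * (p : ℝ)) M)) := by
  constructor
  · intro c hc hnc
    refine ⟨fun h => ⟨hc, ?_⟩, fun h => MatrixSH.isMatrixSuperharmonic_frobeniusPower hn hp hc h.2⟩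
    by_contra hlt
    -- If `c = 0`, excluding `(1, 0)` forces `n ≥ 2`, and then `c ≤ n - 2` holds after all.
    refine MatrixSH.not_isMatrixSuperharmonic_frobeniusPower hn hp (hc.lt_of_ne' fun h0 => ?_)
      (not_le.1 hlt) h
    have hn2 : 2 ≤ n := by
      have : n ≠ 1 := fun h1 => hnc ⟨h1, h0⟩
      omega
    have : (2 : ℝ) ≤ n := by exact_mod_cast hn2
    exact hlt (by rw [h0]; linarith)
  · intro hp2 hnp
    -- This makes `c = n p - 2` positive; the excluded pair `(1, 2)` would give `c = 0`.
    have hnp3 : 3 ≤ n * p := by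
      rcases hn.eq_or_lt with h1 | h1
      · have : p ≠ 2 := fun h2 => hnp ⟨h1.symm, h2⟩
        rw [← h1]
        omega
      · nlinarith
    have h3 : (3 : ℝ) ≤ n * p := by exact_mod_cast hnp3
    have h1 : (1 : ℝ) ≤ n := by exact_mod_cast hn
    have h2 : (2 : ℝ) ≤ p := by exact_mod_cast hp2
    have h := MatrixSH.not_isMatrixSuperharmonic_frobeniusPower (c := n * p - 2) hn hp
      (by linarith) (by nlinarith)
    rwa [neg_sub] at h
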